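/- All manifolds are compact and piecewise linear. A complete boundary pattern on an $n$-manifold $X$ (with or without boundary, not necessarily connected) is a finite collection of compact connected $(n-1)$-manifolds in $\partial X$, called faces, whose union is $\partial X$ and such that the intersection of any $k\ge 1$ of them is empty or an $(n-k)$-manifold (so it is empty if $k>n$). For $k<n$ let $F^kX$ be the set of connected components of the intersections of $n-k$ distinct faces, $f_k(X)=|F^kX|$, and $\chi(F^kX)=\sum_{F\in F^kX}\chi(F)$. For a 4-manifold $X$ with complete boundary pattern put $$\varphi(X)=-\tfrac1{16}f_0(X)+\tfrac14\sum_{F\in F^3X}\chi(F).$$ Let $X$ be a 4-manifold with complete boundary pattern, and let $G\subset X$ be a connected two-sided 3-dimensional submanifold, properly embedded ($\partial G=G\cap\partial X$) and transverse to the boundary pattern, i.e. meeting any intersection of $k$ faces of $X$ in a $(3-k)$-manifold or not at all. Give $G$ the induced boundary pattern, whose faces are the components of the intersections of $G$ with the faces of $X$. Let $Y$ be $X$ cut open along $G$, with the induced boundary pattern, whose faces are the components of the faces of $X$ cut open along $G$ together with the two copies of $G$ in $\partial Y$. Then $$\varphi(Y)=\varphi(X)-\tfrac18 f_0(G)+\tfrac14\bigl(\chi(F^2G)+\chi(\partial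 G)\bigr).$$ In particular this holds when $X$ is a Haken 4-manifold and $G$ is a connected essential hypersurface in $X$. -/

import Mathlib

/-!
Compact piecewise linear manifolds with boundary pattern.  A compact polyhedron is presented by a
finite abstract simplicial complex (Mathlib's `PreAbstractSimplicialComplex` on a finite vertex
type; the empty simplex is never a face), and subpolyhedra by subcomplexes.
-/

namespace PLPattern

section Complexes

variable {V W : Type*} [DecidableEq V] [DecidableEq W]

/-- The Euler characteristic `∑ (-1) ^ dim σ` of a set of simplices (`dim σ = card σ - 1`). -/
noncomputable def eulerChar {V : Type*} (S : Set (Finset V)) : ℤ :=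
  ∑ᶠ σ ∈ S, (-1 : ℤ) ^ (σ.card + 1)

/-- `K` and `L` are isomorphic: a map of vertices, injective on the vertices of `K`, carries the
faces of `K` onto the faces of `L`. -/
def Iso (K : PreAbstractSimplicialComplex V) (L : PreAbstractSimplicialComplex W) : Prop :=
  ∃ f : V → W, Set.InjOn f {v | {v} ∈ K} ∧ K.map f = L

/-- Starring `K` at the face `A` with the new vertex `a`: the open star of `A` is replaced by the
cone `a * ∂A * link A`. -/
def starring (K : PreAbstractSimplicialComplex V) (A : Finset V) (a : V) :
    PreAbstractSimplicialComplex V where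
  faces := {σ | σ ∈ K ∧ ¬ A ⊆ σ} ∪ {σ | ∃ ρ, σ = insert a ρ ∧ ¬ A ⊆ ρ ∧ ρ ∪ A ∈ K}
  isRelLowerSet_faces := by
    rintro σ (⟨hσ, hA⟩ | ⟨ρ, rfl, hA, hρ⟩)
    · refine ⟨(K.isRelLowerSet_faces hσ).1, fun τ hτ hne => Or.inl ⟨?_, fun h => hA (h.trans hτ)⟩⟩
      exact (K.isRelLowerSet_faces hσ).2 hτ hne
    · refine ⟨Finset.insert_nonempty _ _, fun τ hτ hne => ?_⟩
      by_cases ha : a ∈ τ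
      · refine Or.inr ⟨τ.erase a ∩ ρ, ?_, fun h => hA (h.trans Finset.inter_subset_right), ?_⟩
        · ext x
          have := @hτ x
          simp only [Finset.mem_insert, Finset.mem_inter, Finset.mem_erase] at this ⊢
          by_cases hx : x = a
          · simp [hx, ha]
          · simp only [hx, false_or, ne_eq, not_false_eq_true, true_and] at this ⊢
            exact ⟨fun h => ⟨h, this h⟩, fun h => h.1⟩
        · have hAne : A.Nonempty := Finset.nonempty_iff_ne_empty.2 fun h => hA (by simp [h])
          exact (K.isRelLowerSet_faces hρ).2
            (Finset.union_subset_union_left Finset.inter_subset_right)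
            (hAne.mono Finset.subset_union_right)
      · have hτρ : τ ⊆ ρ := fun x hx => by
          rcases Finset.mem_insert.1 (hτ hx) with h | h
          · exact absurd (h ▸ hx) ha
          · exact h
        exact Or.inl ⟨(K.isRelLowerSet_faces hρ).2 (hτρ.trans Finset.subset_union_left) hne,
          fun h => hA (h.trans hτρ)⟩

/-- `L` arises from `K` by one elementary stellar subdivision. -/
def StellarStep (K L : PreAbstractSimplicialComplex V) : Prop :=
  ∃ (A : Finset V) (a : V), A ∈ K ∧ {a} ∉ K ∧ L = starring K A a

/-- Piecewise linear homeomorphism of finite complexes, as combinatorial (stellar) equivalence: after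
labelling the vertices by natural numbers, `K` and `L` are joined by a finite chain of elementary
stellar subdivisions and their inverses. -/
def PLEquiv (K : PreAbstractSimplicialComplex V) (L : PreAbstractSimplicialComplex W) : Prop :=
  ∃ K' L' : PreAbstractSimplicialComplex ℕ,
    Iso K K' ∧ Iso L L' ∧ Relation.EqvGen StellarStep K' L'

/-- The boundary of the standard `d`-simplex (empty for `d = 0`). -/
def simplexBoundary (d : ℕ) : PreAbstractSimplicialComplex (Fin (d + 1)) where
  faces := {σ | σ.Nonempty ∧ σ ≠ Finset.univ}
  isRelLowerSet_faces := fun _ h =>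
    ⟨h.1, fun _ hτ hne => ⟨hne, fun hu => h.2 (Finset.univ_subset_iff.1 (hu ▸ hτ))⟩⟩

/-- `K` is a PL sphere of dimension `d - 1`; for `d = 0` this is the empty complex. -/
def IsSphere (d : ℕ) (K : PreAbstractSimplicialComplex V) : Prop :=
  PLEquiv K (simplexBoundary d)

/-- `K` is a PL ball of dimension `d - 1`, where `d ≥ 1`. -/
def IsBall (d : ℕ) (K : PreAbstractSimplicialComplex V) : Prop :=
  1 ≤ d ∧ PLEquiv K (⊤ : PreAbstractSimplicialComplex (Fin d))

/-- The link of `σ` in `K`. -/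
def link (K : PreAbstractSimplicialComplex V) (σ : Finset V) : PreAbstractSimplicialComplex V where
  faces := {τ | τ.Nonempty ∧ Disjoint τ σ ∧ τ ∪ σ ∈ K}
  isRelLowerSet_faces := fun _ h => ⟨h.1, fun _ hτ hne =>
    ⟨hne, h.2.1.mono_left hτ, (K.isRelLowerSet_faces h.2.2).2
      (Finset.union_subset_union_left hτ) (hne.mono Finset.subset_union_left)⟩⟩

/-- `K` is a PL `n`-manifold, possibly with boundary, possibly empty, not necessarily connected: the
link of each simplex `σ` is a PL sphere or ball of dimension `n - dim σ - 1 = (n + 1 - card σ) - 1`. -/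
def IsManifold (n : ℕ) (K : PreAbstractSimplicialComplex V) : Prop :=
  ∀ σ ∈ K, σ.card ≤ n + 1 ∧
    (IsSphere (n + 1 - σ.card) (link K σ) ∨ IsBall (n + 1 - σ.card) (link K σ))

/-- The simplices of the boundary of a PL `n`-manifold: those whose link is a ball. -/
def boundary (n : ℕ) (K : PreAbstractSimplicialComplex V) : Set (Finset V) :=
  {σ | σ ∈ K ∧ IsBall (n + 1 - σ.card) (link K σ)}

/-- `K` is nonempty and connected. -/
def IsConnected (K : PreAbstractSimplicialComplex V) : Prop :=
  (∃ v, {v} ∈ K) ∧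
    ∀ v w, {v} ∈ K → {w} ∈ K → Relation.ReflTransGen (fun a b => ({a, b} : Finset V) ∈ K) v w

/-- `C` is a connected component of `K`. -/
def IsComponent (C K : PreAbstractSimplicialComplex V) : Prop :=
  C ≤ K ∧ IsConnected C ∧ ∀ σ ∈ K, (∃ v ∈ σ, {v} ∈ C) → σ ∈ C

/-- The inverse image in `L` of a complex `A` under the simplicial map given by `p` on vertices. -/
def preimage (p : W → V) (L : PreAbstractSimplicialComplex W)
    (A : PreAbstractSimplicialComplex V) : PreAbstractSimplicialComplex W where
  faces := {τ | τ ∈ L ∧ τ.image p ∈ A}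
  isRelLowerSet_faces := fun _ h => ⟨(L.isRelLowerSet_faces h.1).1, fun _ hτ hne =>
    ⟨(L.isRelLowerSet_faces h.1).2 hτ hne,
      (A.isRelLowerSet_faces h.2).2 (Finset.image_subset_image hτ) (hne.image p)⟩⟩

end Complexes

/-- A simplicial complex together with a collection of subcomplexes, the faces of the pattern. -/
structure PatternedComplex (V : Type*) where
  carrier : PreAbstractSimplicialComplex V
  pattern : Set (PreAbstractSimplicialComplex V)

section Patterns

variable {V W : Type*} [DecidableEq V] [DecidableEq W]

/-- The intersections of any `k ≥ 1` members of the family `P` of complexes with `K` are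
PL `(n - k)`-manifolds (possibly empty); for `k > n` they are empty. -/
def IntersectsInManifolds (n : ℕ) (K : PreAbstractSimplicialComplex V)
    (P : Set (PreAbstractSimplicialComplex V)) : Prop :=
  ∀ s : Finset (PreAbstractSimplicialComplex V), ↑s ⊆ P → s.Nonempty →
    (s.card ≤ n → IsManifold (n - s.card) (K ⊓ s.inf id)) ∧ (n < s.card → K ⊓ s.inf id = ⊥)

/-- `X` is a PL `n`-manifold with a complete boundary pattern: the faces are connected, their union
is the whole boundary, and any `k` of them meet in an `(n - k)`-manifold or not at all. -/
structure IsPatternedManifold (n : ℕ) (X : PatternedComplex V) : Prop where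
  manifold : IsManifold n X.carrier
  connected : ∀ A ∈ X.pattern, IsConnected A
  complete : {σ | ∃ A ∈ X.pattern, σ ∈ A} = boundary n X.carrier
  inter : IntersectsInManifolds n X.carrier X.pattern

/-- The set `F^k X` of `k`-dimensional elements of the boundary complex of an `n`-dimensional `X`:
the connected components of the intersections of `n - k` distinct faces of the pattern (`k < n`). -/
def faceSet (n k : ℕ) (X : PatternedComplex V) : Set (PreAbstractSimplicialComplex V) :=
  {C | ∃ s : Finset (PreAbstractSimplicialComplex V), ↑s ⊆ X.pattern ∧ s.card + k = n ∧
    IsComponent C (X.carrier ⊓ s.inf id)}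

/-- `f_k(X)`, the number of `k`-dimensional elements of the boundary complex. -/
noncomputable def faceNumber (n k : ℕ) (X : PatternedComplex V) : ℕ :=
  (faceSet n k X).ncard

/-- `χ(F^k X)`, the sum of the Euler characteristics of the `k`-dimensional elements. -/
noncomputable def faceEuler (n k : ℕ) (X : PatternedComplex V) : ℤ :=
  ∑ᶠ C ∈ faceSet n k X, eulerChar C.faces

/-- `φ(X) = -(1/16) f_0(X) + (1/4) ∑ χ(F^3)` for a 4-manifold `X` with boundary pattern. -/
noncomputable def phi (X : PatternedComplex V) : ℝ :=
  -(1 / 16 : ℝ) * faceNumber 4 0 X + (1 / 4 : ℝ) * faceEuler 4 3 X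

/-- `G` is a properly embedded `n`-dimensional submanifold of the patterned `(n + 1)`-manifold `X`,
transverse to the boundary pattern: it meets any intersection of `k` faces in an `(n - k)`-manifold
or not at all. -/
structure IsHypersurface (n : ℕ) (X : PatternedComplex V) (G : PreAbstractSimplicialComplex V) :
    Prop where
  le : G ≤ X.carrier
  manifold : IsManifold n G
  proper : boundary n G = {σ | σ ∈ G ∧ σ ∈ boundary (n + 1) X.carrier}
  transverse : IntersectsInManifolds n G X.pattern

/-- `G` with the boundary pattern induced from `X`: its faces are the components of the
intersections of `G` with the faces of `X`. -/
def induced (X : PatternedComplex V) (G : PreAbstractSimplicialComplex V) : PatternedComplex V where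
  carrier := G
  pattern := {C | ∃ A ∈ X.pattern, IsComponent C (G ⊓ A)}

/-- `Y`, with its induced pattern, is `X` cut open along `G`: there are disjoint subcomplexes `Gp`, `Gm`
of `Y` and a simplicial regluing map `p` from `Y` to `X`, injective on each simplex, which carries
each of `Gp`, `Gm` isomorphically onto `G` and is bijective from the other simplices of `Y` to the
simplices of `X` outside `G`.  The faces of `Y` are the components of the faces of `X` cut open
along `G`, and the two copies `Gp`, `Gm` of `G`. -/
def IsCutOpen (X : PatternedComplex V) (G : PreAbstractSimplicialComplex V)
    (Y : PatternedComplex W) : Prop :=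
  ∃ (p : W → V) (Gp Gm : PreAbstractSimplicialComplex W),
    (∀ τ ∈ Y.carrier, τ.image p ∈ X.carrier ∧ Set.InjOn p τ) ∧
    Gp ≤ Y.carrier ∧ Gm ≤ Y.carrier ∧ Gp ⊓ Gm = ⊥ ∧
    Set.BijOn (Finset.image p) Gp.faces G.faces ∧
    Set.BijOn (Finset.image p) Gm.faces G.faces ∧
    Set.BijOn (Finset.image p) (Y.carrier.faces \ (Gp.faces ∪ Gm.faces))
      (X.carrier.faces \ G.faces) ∧
    Y.pattern = {C | ∃ A ∈ X.pattern, IsComponent C (preimage p Y.carrier A)} ∪ {Gp, Gm}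

end Patterns

end PLPattern

/-! The formula is bookkeeping of two counts. Three-dimensional faces: the simplices of a face `A`
lying in `G` are doubled by the cut, so the cut face has Euler characteristic `χ(A) + χ(G ∩ A)`.
Summed over `A`, the corrections give `χ(F²G)`. The two copies of `G` are further faces and
contribute `2 χ(G)`, which equals `χ(∂G)` because `G` is compact of odd dimension
(`eulerChar_boundary_of_odd`). Hence `χ(F³Y) = χ(F³X) + χ(F²G) + χ(∂G)`. Vertices: `f_0` counts the
vertices lying in at least as many faces as the dimension (`faceNumber_zero`). By transversality no
vertex of `G` lies in four faces of `X`, so the old ones survive unchanged. One lying in three faces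
of `X` has two lifts, each in three cut faces and one copy of `G`. Hence `f_0(Y) = f_0(X) + 2
f_0(G)`, and `-1/16 · 2 = -1/8`. Faces being components of intersections, both counts need distinct
faces to yield distinct components. This is a dimension argument: a shared component would contain a
simplex too large for the intersection of two faces (`IsHypersurface.eq_of_isComponent`).
`sum_eulerChar_components` and `ncard_components_mem` then replace components by whole
intersections. -/

namespace PLPattern

/-! ### Euler characteristic and its invariance under stellar moves -/

section EulerCharacteristic

variable {V W : Type*}

theorem mem_faces {K : PreAbstractSimplicialComplex V} {σ : Finset V} : σ ∈ K.faces ↔ σ ∈ K :=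
  Iff.rfl

theorem nonempty_of_mem {K : PreAbstractSimplicialComplex V} {σ : Finset V} (h : σ ∈ K) :
    σ.Nonempty :=
  (K.isRelLowerSet_faces h).1

theorem mem_of_subset {K : PreAbstractSimplicialComplex V} {σ τ : Finset V} (h : σ ∈ K)
    (hτ : τ ⊆ σ) (hne : τ.Nonempty) : τ ∈ K :=
  (K.isRelLowerSet_faces h).2 hτ hne

theorem eulerChar_coe (S : Finset (Finset V)) :
    eulerChar (S : Set (Finset V)) = ∑ σ ∈ S, (-1 : ℤ) ^ (σ.card + 1) :=
  finsum_mem_coe_finset _ _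

theorem eulerChar_union {S T : Set (Finset V)} (h : Disjoint S T) (hS : S.Finite) (hT : T.Finite) :
    eulerChar (S ∪ T) = eulerChar S + eulerChar T :=
  finsum_mem_union h hS hT

/-- All terms are `±1`, so an infinite sum takes the default value 0 of `finsum`. A stellar chain
runs through complexes on `ℕ` that are not assumed finite; this value covers the infinite ones. -/
theorem eulerChar_eq_zero_of_infinite {S : Set (Finset V)} (h : ¬ S.Finite) : eulerChar S = 0 := by
  refine finsum_mem_eq_zero_of_infinite ?_
  convert h using 2
  ext σ
  simp

theorem eulerChar_of_bijOn {S : Set (Finset V)} {T : Set (Finset W)} (f : Finset V → Finset W)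
    (hf : Set.BijOn f S T) (hcard : ∀ σ ∈ S, (f σ).card = σ.card) : eulerChar S = eulerChar T :=
  finsum_mem_eq_of_bijOn f hf fun σ hσ => by rw [hcard σ hσ]

/-- A set of simplices (possibly containing the empty one) closed under adding and removing a
fixed vertex has vanishing alternating sum. -/
theorem sum_neg_one_pow_eq_zero_of_toggle [DecidableEq V] (S : Finset (Finset V)) (x : V)
    (h : ∀ σ, insert x σ ∈ S ↔ σ.erase x ∈ S) : ∑ σ ∈ S, (-1 : ℤ) ^ σ.card = 0 := by
  refine Finset.sum_involution (fun σ _ => if x ∈ σ then σ.erase x else insert x σ) ?_ ?_ ?_ ?_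
  · intro σ _
    by_cases hx : x ∈ σ
    · have := Finset.card_erase_add_one hx
      simp only [hx, if_true, ← this, pow_succ]
      ring
    · simp only [hx, if_false, Finset.card_insert_of_notMem hx, pow_succ]
      ring
  · intro σ _ _ he
    by_cases hx : x ∈ σ
    · simp only [hx, if_true] at he
      exact Finset.notMem_erase x σ (he.symm ▸ hx)
    · simp only [hx, if_false] at he
      exact hx (he ▸ Finset.mem_insert_self x σ)
  · intro σ hσ
    by_cases hx : x ∈ σ
    · simp only [hx, if_true]
      rw [← h, Finset.insert_eq_of_mem hx]
      exact hσ
    · simp only [hx, if_false]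
      rw [h, Finset.erase_eq_of_notMem hx]
      exact hσ
  · intro σ _
    by_cases hx : x ∈ σ
    · simp [hx]
    · simp [hx]

theorem iso_bijOn [DecidableEq V] [DecidableEq W] {K : PreAbstractSimplicialComplex V}
    {f : V → W} (hf : Set.InjOn f {v | {v} ∈ K}) :
    Set.BijOn (Finset.image f) K.faces (K.map f).faces ∧
      ∀ σ ∈ K.faces, (σ.image f).card = σ.card := by
  have hsub : ∀ σ ∈ K, (σ : Set V) ⊆ {v | {v} ∈ K} := fun σ hσ v hv =>
    mem_of_subset hσ (Finset.singleton_subset_iff.2 hv) (Finset.singleton_nonempty v)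
  refine ⟨⟨fun σ hσ => ⟨σ, hσ, rfl⟩, fun σ hσ τ hτ he => ?_, fun _ h => h⟩, fun σ hσ =>
    Finset.card_image_of_injOn (hf.mono (hsub σ hσ))⟩
  have he' : f '' (σ : Set V) = f '' (τ : Set V) := by
    rw [← Finset.coe_image, ← Finset.coe_image]; exact congrArg _ he
  exact Finset.coe_injective ((hf.image_eq_image_iff (hsub σ hσ) (hsub τ hτ)).1 he')

/-- Two complexes, both finite or both infinite and both empty or both nonempty, with equal Euler
characteristics. -/
structure SameEuler (K : PreAbstractSimplicialComplex V) (L : PreAbstractSimplicialComplex W) :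
    Prop where
  finite_iff : K.faces.Finite ↔ L.faces.Finite
  eulerChar_eq : eulerChar K.faces = eulerChar L.faces
  nonempty_iff : K.faces.Nonempty ↔ L.faces.Nonempty

theorem SameEuler.refl (K : PreAbstractSimplicialComplex V) : SameEuler K K :=
  ⟨Iff.rfl, rfl, Iff.rfl⟩

theorem SameEuler.symm {K : PreAbstractSimplicialComplex V} {L : PreAbstractSimplicialComplex W}
    (h : SameEuler K L) : SameEuler L K :=
  ⟨h.1.symm, h.2.symm, h.3.symm⟩

theorem SameEuler.trans {U : Type*} {K : PreAbstractSimplicialComplex V}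
    {L : PreAbstractSimplicialComplex W} {M : PreAbstractSimplicialComplex U}
    (h : SameEuler K L) (h' : SameEuler L M) : SameEuler K M :=
  ⟨h.1.trans h'.1, h.2.trans h'.2, h.3.trans h'.3⟩

theorem Iso.sameEuler [DecidableEq V] [DecidableEq W] {K : PreAbstractSimplicialComplex V}
    {L : PreAbstractSimplicialComplex W} (h : Iso K L) : SameEuler K L := by
  obtain ⟨f, hf, rfl⟩ := h
  obtain ⟨hb, hc⟩ := iso_bijOn hf
  refine ⟨⟨fun h => hb.image_eq ▸ h.image _, fun h => ?_⟩, eulerChar_of_bijOn _ hb hc, ?_⟩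
  · exact Set.Finite.of_finite_image (hb.image_eq ▸ h) hb.injOn
  · rw [← hb.image_eq, Set.image_nonempty]

variable [DecidableEq V]

theorem starring_finite {K : PreAbstractSimplicialComplex V} {A : Finset V} {a : V}
    (hK : K.faces.Finite) : (starring K A a).faces.Finite := by
  have h1 : {ρ : Finset V | ρ ∪ A ∈ K}.Finite := by
    refine (hK.biUnion (t := fun σ => {ρ | ρ ⊆ σ}) fun σ _ => ?_).subset fun ρ hρ => ?_
    · exact (Finset.finite_toSet σ.powerset).subset fun ρ hρ => by simpa using hρ
    · exact Set.mem_biUnion (show ρ ∪ A ∈ K.faces from hρ) Finset.subset_union_left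
  refine (hK.union (h1.image (insert a))).subset ?_
  rintro σ (⟨h, -⟩ | ⟨ρ, rfl, -, h⟩)
  · exact Or.inl h
  · exact Or.inr ⟨ρ, h, rfl⟩

/-- Only simplices `σ ⊇ A` are lost, and each is recovered from the new simplex `insert a (σ.erase
x)`, where `x ∈ A`. -/
theorem finite_of_starring {K : PreAbstractSimplicialComplex V} {A : Finset V} {a : V}
    (hA : A.Nonempty) (ha : {a} ∉ K) (h : (starring K A a).faces.Finite) : K.faces.Finite := by
  obtain ⟨x, hx⟩ := hA
  refine (h.union (h.image fun τ => insert x (τ.erase a))).subset fun σ hσ => ?_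
  by_cases hAσ : A ⊆ σ
  · right
    have haσ : a ∉ σ := fun h => ha (mem_of_subset hσ (by simpa using h) (by simp))
    refine ⟨insert a (σ.erase x), Or.inr ⟨_, rfl, fun h => by simpa using h hx, ?_⟩, ?_⟩
    · rwa [show σ.erase x ∪ A = σ from ?_]
      ext y
      have := @hAσ y
      by_cases hy : y = x <;> simp_all
    · have : a ∉ σ.erase x := fun h => haσ (Finset.mem_of_mem_erase h)
      simp only [Finset.erase_insert this, Finset.insert_erase (hAσ hx)]
  · exact Or.inl (Or.inl ⟨hσ, hAσ⟩)

/-- The difference between added and removed simplices is the alternating sum over all `ρ`, empty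
one included, with `ρ ∪ A ∈ K`. It vanishes, since toggling a vertex `x ∈ A` in `ρ` leaves `ρ ∪ A`
unchanged. -/
theorem eulerChar_starring {K : PreAbstractSimplicialComplex V} {A : Finset V} {a : V}
    (hA : A ∈ K) (ha : {a} ∉ K) (hK : K.faces.Finite) :
    eulerChar (starring K A a).faces = eulerChar K.faces := by
  obtain ⟨x, hx⟩ := nonempty_of_mem hA
  have hsub : ∀ {ρ}, ρ ∪ A ∈ K → a ∉ ρ := fun {ρ} h h' =>
    ha (mem_of_subset h (by simp [h']) (by simp))
  have hfin : {ρ : Finset V | ρ ∪ A ∈ K}.Finite := by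
    refine (hK.biUnion (t := fun σ => {ρ | ρ ⊆ σ}) fun σ _ => ?_).subset fun ρ hρ => ?_
    · exact (Finset.finite_toSet σ.powerset).subset fun ρ hρ => by simpa using hρ
    · exact Set.mem_biUnion (show ρ ∪ A ∈ K.faces from hρ) Finset.subset_union_left
  -- the three families of simplices
  have hK_split : K.faces = {σ | σ ∈ K ∧ ¬ A ⊆ σ} ∪ {σ | A ⊆ σ ∧ σ ∪ A ∈ K} := by
    ext σ
    by_cases h : A ⊆ σ
    · simp [h, Finset.union_eq_left.2 h, mem_faces]
    · simp [h, mem_faces]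
  have hd1 : Disjoint {σ | σ ∈ K ∧ ¬ A ⊆ σ} {σ | A ⊆ σ ∧ σ ∪ A ∈ K} :=
    Set.disjoint_left.2 fun σ h h' => h.2 h'.1
  have hL_split : (starring K A a).faces =
      {σ | σ ∈ K ∧ ¬ A ⊆ σ} ∪ insert a '' {ρ | ¬ A ⊆ ρ ∧ ρ ∪ A ∈ K} := by
    ext σ
    constructor
    · rintro (h | ⟨ρ, rfl, h⟩)
      · exact Or.inl h
      · exact Or.inr ⟨ρ, h, rfl⟩
    · rintro (h | ⟨ρ, h, rfl⟩)
      · exact Or.inl h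
      · exact Or.inr ⟨ρ, rfl, h⟩
  have hd2 : Disjoint {σ | σ ∈ K ∧ ¬ A ⊆ σ} (insert a '' {ρ | ¬ A ⊆ ρ ∧ ρ ∪ A ∈ K}) := by
    refine Set.disjoint_left.2 ?_
    rintro _ h ⟨ρ, -, rfl⟩
    exact ha (mem_of_subset h.1 (by simp) (by simp))
  have hf0 : {σ | σ ∈ K ∧ ¬ A ⊆ σ}.Finite := hK.subset fun _ h => h.1
  have hf1 : {σ : Finset V | A ⊆ σ ∧ σ ∪ A ∈ K}.Finite := hfin.subset fun _ h => h.2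
  have hf2 : {σ : Finset V | ¬ A ⊆ σ ∧ σ ∪ A ∈ K}.Finite := hfin.subset fun _ h => h.2
  rw [hK_split, hL_split, eulerChar_union hd1 hf0 hf1, eulerChar_union hd2 hf0 (hf2.image _)]
  congr 1
  have hinj : Set.InjOn (insert a) {ρ : Finset V | ¬ A ⊆ ρ ∧ ρ ∪ A ∈ K} := fun ρ h ρ' h' he => by
    rw [← Finset.erase_insert (hsub h.2), ← Finset.erase_insert (hsub h'.2), he]
  have h1 : eulerChar (insert a '' {ρ | ¬ A ⊆ ρ ∧ ρ ∪ A ∈ K}) =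
      ∑ᶠ ρ ∈ {ρ | ¬ A ⊆ ρ ∧ ρ ∪ A ∈ K}, (-1 : ℤ) ^ ρ.card := by
    rw [eulerChar, finsum_mem_image hinj]
    refine finsum_mem_congr rfl fun ρ hρ => ?_
    rw [Finset.card_insert_of_notMem (hsub hρ.2)]
    ring
  have h2 : eulerChar {σ | A ⊆ σ ∧ σ ∪ A ∈ K} =
      -∑ᶠ ρ ∈ {ρ | A ⊆ ρ ∧ ρ ∪ A ∈ K}, (-1 : ℤ) ^ ρ.card := by
    rw [eulerChar, ← finsum_mem_neg_distrib _ hf1]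
    refine finsum_mem_congr rfl fun ρ _ => ?_
    ring
  have h3 : ∑ᶠ ρ ∈ {ρ : Finset V | ρ ∪ A ∈ K}, (-1 : ℤ) ^ ρ.card = 0 := by
    rw [finsum_mem_eq_finite_toFinset_sum _ hfin]
    refine sum_neg_one_pow_eq_zero_of_toggle _ x fun σ => ?_
    simp only [Set.Finite.mem_toFinset, Set.mem_ofPred_eq]
    rw [show insert x σ ∪ A = σ.erase x ∪ A from ?_]
    ext y
    by_cases hy : y = x <;> simp_all
  have h4 : {ρ : Finset V | ρ ∪ A ∈ K} =
      {ρ | ¬ A ⊆ ρ ∧ ρ ∪ A ∈ K} ∪ {ρ | A ⊆ ρ ∧ ρ ∪ A ∈ K} := by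
    ext ρ
    by_cases h : A ⊆ ρ <;> simp [h]
  rw [h4, finsum_mem_union (Set.disjoint_left.2 fun σ h h' => h.1 h'.1) hf2 hf1] at h3
  rw [h1, h2]
  linarith

theorem StellarStep.sameEuler {K L : PreAbstractSimplicialComplex V} (h : StellarStep K L) :
    SameEuler K L := by
  obtain ⟨A, a, hA, ha, rfl⟩ := h
  have hne := nonempty_of_mem hA
  have hiff : K.faces.Finite ↔ (starring K A a).faces.Finite :=
    ⟨starring_finite, finite_of_starring hne ha⟩
  refine ⟨hiff, ?_, iff_of_true ⟨A, hA⟩ ⟨{a}, Or.inr ⟨∅, rfl, ?_, ?_⟩⟩⟩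
  · by_cases hK : K.faces.Finite
    · exact (eulerChar_starring hA ha hK).symm
    · rw [eulerChar_eq_zero_of_infinite hK, eulerChar_eq_zero_of_infinite (mt hiff.2 hK)]
  · rw [Finset.subset_empty]; exact hne.ne_empty
  · rwa [Finset.empty_union]

theorem PLEquiv.sameEuler [DecidableEq W] {K : PreAbstractSimplicialComplex V}
    {L : PreAbstractSimplicialComplex W} (h : PLEquiv K L) : SameEuler K L := by
  obtain ⟨K', L', hK, hL, h⟩ := h
  refine hK.sameEuler.trans (SameEuler.trans ?_ hL.sameEuler.symm)
  clear hK hL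
  induction h with
  | rel _ _ h => exact h.sameEuler
  | refl => exact SameEuler.refl _
  | symm _ _ _ ih => exact ih.symm
  | trans _ _ _ _ _ ih ih' => exact ih.trans ih'

theorem eulerChar_simplexBoundary (d : ℕ) :
    eulerChar (simplexBoundary d).faces = 1 - (-1) ^ d := by
  have h : (simplexBoundary d).faces =
      (((Finset.univ : Finset (Finset (Fin (d + 1)))).erase ∅).erase Finset.univ :
        Finset (Finset (Fin (d + 1)))) := by
    ext σ
    simp [simplexBoundary, Finset.nonempty_iff_ne_empty]
  have h0 := Finset.sum_powerset_neg_one_pow_card_of_nonempty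
    (x := (Finset.univ : Finset (Fin (d + 1)))) ⟨0, Finset.mem_univ _⟩
  rw [Finset.powerset_univ, ← Finset.add_sum_erase _ _ (Finset.mem_univ ∅),
    ← Finset.add_sum_erase _ _ (show Finset.univ ∈ Finset.univ.erase ∅ by
      simp [Finset.univ_nonempty.ne_empty])] at h0
  rw [h, eulerChar_coe]
  simp only [Finset.card_empty, pow_zero, Finset.card_univ, Fintype.card_fin, pow_succ] at h0 ⊢
  rw [← Finset.sum_mul]
  linarith

theorem eulerChar_top_fin {d : ℕ} (hd : 1 ≤ d) :
    eulerChar (⊤ : PreAbstractSimplicialComplex (Fin d)).faces = 1 := by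
  have h : (⊤ : PreAbstractSimplicialComplex (Fin d)).faces =
      ((Finset.univ : Finset (Finset (Fin d))).erase ∅ : Finset (Finset (Fin d))) := by
    ext σ
    simp only [Finset.coe_erase, Finset.coe_univ, Set.mem_sdiff, Set.mem_univ, true_and,
      Set.mem_singleton_iff, ← Finset.nonempty_iff_ne_empty]
    exact Iff.rfl
  have h0 := Finset.sum_powerset_neg_one_pow_card_of_nonempty
    (x := (Finset.univ : Finset (Fin d))) ⟨⟨0, hd⟩, Finset.mem_univ _⟩
  rw [Finset.powerset_univ, ← Finset.add_sum_erase _ _ (Finset.mem_univ ∅)] at h0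
  rw [h, eulerChar_coe]
  simp only [Finset.card_empty, pow_zero, pow_succ] at h0 ⊢
  rw [← Finset.sum_mul]
  linarith

theorem IsSphere.eulerChar_eq {d : ℕ} {K : PreAbstractSimplicialComplex V} (h : IsSphere d K) :
    eulerChar K.faces = 1 - (-1) ^ d := by
  rw [(PLEquiv.sameEuler h).eulerChar_eq, eulerChar_simplexBoundary]

theorem IsBall.eulerChar_eq {d : ℕ} {K : PreAbstractSimplicialComplex V} (h : IsBall d K) :
    eulerChar K.faces = 1 := by
  rw [(PLEquiv.sameEuler h.2).eulerChar_eq, eulerChar_top_fin h.1]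

theorem IsBall.nonempty {d : ℕ} {K : PreAbstractSimplicialComplex V} (h : IsBall d K) :
    K.faces.Nonempty :=
  (PLEquiv.sameEuler h.2).nonempty_iff.2 ⟨{⟨0, h.1⟩}, Finset.singleton_nonempty _⟩

/-- Euler characteristic cannot distinguish an odd-dimensional sphere from the empty complex, so
nonemptiness is carried separately along the stellar chain. -/
theorem IsSphere.nonempty {d : ℕ} {K : PreAbstractSimplicialComplex V} (h : IsSphere d K)
    (hd : d ≠ 0) : K.faces.Nonempty :=
  (PLEquiv.sameEuler h).nonempty_iff.2 ⟨{0}, Finset.singleton_nonempty _, fun he => by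
    have := congrArg Finset.card he
    simp at this
    omega⟩

end EulerCharacteristic

/-! ### Links, purity, and the boundary of an odd-dimensional manifold -/

section Manifolds

theorem finite_faces {V : Type*} [Finite V] (K : PreAbstractSimplicialComplex V) :
    K.faces.Finite :=
  Set.toFinite _

instance {V : Type*} [Finite V] : Finite (PreAbstractSimplicialComplex V) :=
  Finite.of_injective (fun K : PreAbstractSimplicialComplex V => K.faces)
    fun _ _ h => PreAbstractSimplicialComplex.ext h

theorem exists_maximal_face {V : Type*} [Finite V]
    {K : PreAbstractSimplicialComplex V} {σ : Finset V} (hσ : σ ∈ K) :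
    ∃ τ ∈ K, σ ⊆ τ ∧ ∀ ρ ∈ K, τ ⊆ ρ → ρ = τ := by
  obtain ⟨τ, hle, hτ⟩ := (finite_faces K).exists_le_maximal hσ
  exact ⟨τ, hτ.prop, hle, fun ρ hρ h => (hτ.le_of_ge hρ h).antisymm h⟩

theorem singleton_mem {V : Type*} {K : PreAbstractSimplicialComplex V} {σ : Finset V} (h : σ ∈ K)
    {v : V} (hv : v ∈ σ) : {v} ∈ K :=
  mem_of_subset h (Finset.singleton_subset_iff.2 hv) (Finset.singleton_nonempty v)

variable {V : Type*} [DecidableEq V]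

theorem mem_link {K : PreAbstractSimplicialComplex V} {σ τ : Finset V} :
    τ ∈ link K σ ↔ τ.Nonempty ∧ Disjoint τ σ ∧ τ ∪ σ ∈ K :=
  Iff.rfl

theorem sum_faces_subset (S : Finset (Finset V)) (K : PreAbstractSimplicialComplex V)
    (hS : (S : Set (Finset V)) = K.faces) {τ : Finset V} (hτ : τ ∈ K) :
    ∑ σ ∈ S with σ ⊆ τ, (-1 : ℤ) ^ σ.card = -1 := by
  have hS' : ∀ σ, σ ∈ S ↔ σ ∈ K := fun σ => by rw [← Finset.mem_coe, hS, mem_faces]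
  have h : S.filter (· ⊆ τ) = τ.powerset.erase ∅ := by
    ext σ
    simp only [Finset.mem_filter, hS', Finset.mem_erase, Finset.mem_powerset]
    exact ⟨fun h => ⟨(nonempty_of_mem h.1).ne_empty, h.2⟩, fun h =>
      ⟨mem_of_subset hτ h.2 (Finset.nonempty_iff_ne_empty.2 h.1), h.2⟩⟩
  have h0 := Finset.sum_powerset_neg_one_pow_card_of_nonempty (nonempty_of_mem hτ)
  rw [← Finset.add_sum_erase _ _ (Finset.empty_mem_powerset τ)] at h0
  rw [h]
  simp only [Finset.card_empty, pow_zero] at h0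
  linarith

/-- The simplices properly containing `σ` are the `ρ ∪ σ` with `ρ` in the link; `σ` itself gives the
1. -/
theorem sum_faces_superset (S : Finset (Finset V)) (K : PreAbstractSimplicialComplex V)
    (hS : (S : Set (Finset V)) = K.faces) {σ : Finset V} (hσ : σ ∈ K) :
    ∑ τ ∈ S with σ ⊆ τ, (-1 : ℤ) ^ τ.card =
      (-1) ^ σ.card * (1 - eulerChar (link K σ).faces) := by
  have hS' : ∀ σ, σ ∈ S ↔ σ ∈ K := fun σ => by rw [← Finset.mem_coe, hS, mem_faces]
  have hL : (link K σ).faces = (((S.filter (σ ⊆ ·)).erase σ).image (· \ σ) : Finset (Finset V)) := by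
    ext ρ
    simp only [Finset.coe_image, Set.mem_image, Finset.mem_coe, Finset.mem_erase,
      Finset.mem_filter, hS', mem_faces, mem_link]
    constructor
    · rintro ⟨hne, hd, hmem⟩
      refine ⟨ρ ∪ σ, ⟨fun h => ?_, hmem, Finset.subset_union_right⟩, ?_⟩
      · exact hne.ne_empty (Finset.disjoint_self_iff_empty ρ |>.1
          (hd.mono_right (Finset.union_eq_right.1 h)))
      · rw [Finset.union_sdiff_right, Finset.sdiff_eq_self_of_disjoint hd]
    · rintro ⟨τ, ⟨hne, hτ, hsub⟩, rfl⟩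
      refine ⟨?_, Finset.sdiff_disjoint, ?_⟩
      · rw [Finset.sdiff_nonempty]
        exact fun h => hne (h.antisymm hsub)
      · rwa [Finset.sdiff_union_of_subset hsub]
  rw [hL, eulerChar_coe, Finset.sum_image, ← Finset.add_sum_erase _ _
    (show σ ∈ S.filter (σ ⊆ ·) by simp [hS', hσ]), mul_sub, mul_one, sub_eq_add_neg,
    Finset.mul_sum, ← Finset.sum_neg_distrib]
  · congr 1
    refine Finset.sum_congr rfl fun τ hτ => ?_
    simp only [Finset.mem_erase, Finset.mem_filter] at hτ
    rw [← Finset.card_sdiff_add_card_eq_card hτ.2.2]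
    ring
  · intro τ hτ τ' hτ' he
    simp only [Finset.coe_erase, Finset.coe_filter, Set.mem_sdiff, Set.mem_ofPred_eq] at hτ hτ'
    rw [← Finset.sdiff_union_of_subset hτ.1.2, ← Finset.sdiff_union_of_subset hτ'.1.2]
    exact congrArg (· ∪ σ) he

/-- Both sides sum `(-1) ^ (|σ| + |τ|)` over pairs `σ ⊆ τ`: for fixed `σ` the cofaces give the link
term, for fixed `τ` the nonempty subsets give one sign. -/
theorem sum_one_sub_eulerChar_link (S : Finset (Finset V)) (K : PreAbstractSimplicialComplex V)
    (hS : (S : Set (Finset V)) = K.faces) :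
    ∑ σ ∈ S, (1 - eulerChar (link K σ).faces) = eulerChar K.faces := by
  have hS' : ∀ σ, σ ∈ S ↔ σ ∈ K := fun σ => by rw [← Finset.mem_coe, hS, mem_faces]
  have hsq : ∀ k : ℕ, (-1 : ℤ) ^ k * (-1) ^ k = 1 := fun k => by
    rw [← mul_pow]; norm_num
  calc ∑ σ ∈ S, (1 - eulerChar (link K σ).faces)
      = ∑ σ ∈ S, ∑ τ ∈ S, if σ ⊆ τ then (-1 : ℤ) ^ σ.card * (-1) ^ τ.card else 0 := by
        refine Finset.sum_congr rfl fun σ hσ => ?_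
        rw [← Finset.sum_filter, ← Finset.mul_sum,
          sum_faces_superset S K hS ((hS' σ).1 hσ), ← mul_assoc, hsq, one_mul]
    _ = ∑ τ ∈ S, ∑ σ ∈ S, if σ ⊆ τ then (-1 : ℤ) ^ σ.card * (-1) ^ τ.card else 0 :=
        Finset.sum_comm
    _ = ∑ τ ∈ S, (-1 : ℤ) ^ (τ.card + 1) := by
        refine Finset.sum_congr rfl fun τ hτ => ?_
        rw [← Finset.sum_filter, ← Finset.sum_mul, sum_faces_subset S K hS ((hS' τ).1 hτ)]
        ring
    _ = eulerChar K.faces := by rw [← hS, eulerChar_coe]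

/-- The boundary of a compact odd-dimensional manifold has twice its Euler characteristic. -/
theorem eulerChar_boundary_of_odd {n : ℕ} (hn : Odd n) {K : PreAbstractSimplicialComplex V}
    (hfin : K.faces.Finite) (hK : IsManifold n K) :
    eulerChar (boundary n K) = 2 * eulerChar K.faces := by
  classical
  have hS : ((hfin.toFinset : Finset (Finset V)) : Set (Finset V)) = K.faces := hfin.coe_toFinset
  have hS' : ∀ σ, σ ∈ hfin.toFinset ↔ σ ∈ K := fun σ => by rw [← Finset.mem_coe, hS, mem_faces]
  have hB : boundary n K =
      ((hfin.toFinset.filter (· ∈ boundary n K) : Finset (Finset V)) : Set (Finset V)) := by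
    ext σ
    simp only [Finset.coe_filter, hS', Set.mem_ofPred_eq]
    exact ⟨fun h => ⟨h.1, h⟩, fun h => h.2⟩
  have h1 := sum_one_sub_eulerChar_link _ K hS
  have h2 : ∀ σ ∈ hfin.toFinset, 1 - eulerChar (link K σ).faces =
      if σ ∈ boundary n K then 0 else -(-1 : ℤ) ^ (σ.card + 1) := by
    intro σ hσ
    have hσK := (hS' σ).1 hσ
    -- A ball link contributes 0. A sphere link contributes `(-1) ^ (n + 1 - |σ|)`, which is `(-1) ^
    -- |σ|` because `n + 1` is even.
    split_ifs with h
    · rw [h.2.eulerChar_eq, sub_self]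
    · obtain ⟨hc, hs | hb⟩ := hK σ hσK
      · rw [hs.eulerChar_eq, sub_sub_cancel]
        obtain ⟨k, hk⟩ := Nat.exists_eq_add_of_le hc
        have h3 : (-1 : ℤ) ^ (n + 1) = 1 := hn.add_one.neg_one_pow
        rw [hk, pow_add] at h3
        rw [hk, Nat.add_sub_cancel_left, pow_succ]
        rcases neg_one_pow_eq_or ℤ σ.card with h4 | h4 <;> rw [h4] at h3 ⊢ <;> linarith
      · exact absurd ⟨hσK, hb⟩ h
  have h3 : eulerChar K.faces = ∑ σ ∈ hfin.toFinset, (-1 : ℤ) ^ (σ.card + 1) := by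
    rw [← eulerChar_coe, hS]
  have h4 : eulerChar (boundary n K) =
      ∑ σ ∈ hfin.toFinset, if σ ∈ boundary n K then (-1 : ℤ) ^ (σ.card + 1) else 0 := by
    rw [← Finset.sum_filter, ← eulerChar_coe, ← hB]
  -- The left `χ(K)` is expanded over simplices and the right one over links, making the identity
  -- termwise.
  have h5 : eulerChar (boundary n K) - eulerChar K.faces = eulerChar K.faces := by
    rw [h4, ← h1]
    nth_rewrite 1 [h1]
    rw [h3, ← Finset.sum_sub_distrib]
    refine Finset.sum_congr rfl fun σ hσ => ?_
    rw [h2 σ hσ]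
    split_ifs <;> ring
  linarith

/-- The maximal simplices of an `n`-manifold are `n`-dimensional. -/
theorem IsManifold.card_of_maximal {n : ℕ} {K : PreAbstractSimplicialComplex V}
    (hK : IsManifold n K) {σ : Finset V} (hσ : σ ∈ K) (hmax : ∀ τ ∈ K, σ ⊆ τ → τ = σ) :
    σ.card = n + 1 := by
  have hlink : ¬ (link K σ).faces.Nonempty := by
    rintro ⟨τ, hne, hd, hτ⟩
    have := hmax _ hτ Finset.subset_union_right
    exact hne.ne_empty (Finset.disjoint_self_iff_empty τ |>.1
      (hd.mono_right (Finset.union_eq_right.1 this)))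
  obtain ⟨hc, hs | hb⟩ := hK σ hσ
  -- The link is empty, and among spheres only the one with `d = 0` is.
  · by_contra hne
    exact hlink (hs.nonempty (by omega))
  · exact absurd hb.nonempty hlink

variable [Finite V]

theorem IsManifold.exists_card_eq {n : ℕ} {K : PreAbstractSimplicialComplex V}
    (hK : IsManifold n K) {σ : Finset V} (hσ : σ ∈ K) : ∃ τ ∈ K, σ ⊆ τ ∧ τ.card = n + 1 := by
  obtain ⟨τ, hτ, hle, hmax⟩ := exists_maximal_face hσ
  exact ⟨τ, hτ, hle, hK.card_of_maximal hτ hmax⟩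

end Manifolds

/-! ### Connected components of a complex -/

section Components

variable {V : Type*} [DecidableEq V]

theorem IsConnected.exists_mem {K : PreAbstractSimplicialComplex V} (h : IsConnected K) :
    ∃ σ, σ ∈ K :=
  h.1.imp' singleton fun _ h => h

/-- A connected subcomplex that shares a simplex with a component lies in it. -/
theorem IsComponent.le_of_mem {B C D : PreAbstractSimplicialComplex V} (hC : IsComponent C B)
    (hDB : D ≤ B) (hD : IsConnected D) {σ : Finset V} (hσC : σ ∈ C) (hσD : σ ∈ D) : D ≤ C := by
  obtain ⟨v, hv⟩ := nonempty_of_mem hσC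
  have key : ∀ w, Relation.ReflTransGen (fun a b => ({a, b} : Finset V) ∈ D) v w → {w} ∈ C := by
    intro w h
    induction h with
    | refl => exact singleton_mem hσC hv
    | tail _ hbc ih =>
      exact singleton_mem (hC.2.2 _ (hDB hbc) ⟨_, Finset.mem_insert_self _ _, ih⟩) (by simp)
  intro τ hτ
  obtain ⟨w, hw⟩ := nonempty_of_mem (mem_faces.1 hτ)
  exact hC.2.2 τ (hDB hτ) ⟨w, hw, key w (hD.2 v w (singleton_mem hσD hv) (singleton_mem hτ hw))⟩

theorem IsComponent.eq_of_mem {B C D : PreAbstractSimplicialComplex V} (hC : IsComponent C B)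
    (hD : IsComponent D B) {σ : Finset V} (hσC : σ ∈ C) (hσD : σ ∈ D) : C = D :=
  le_antisymm (hD.le_of_mem hC.1 hC.2.1 hσD hσC) (hC.le_of_mem hD.1 hD.2.1 hσC hσD)

theorem IsConnected.isComponent_iff {B C : PreAbstractSimplicialComplex V} (hB : IsConnected B) :
    IsComponent C B ↔ C = B := by
  have h : IsComponent B B := ⟨le_rfl, hB, fun _ h _ => h⟩
  refine ⟨fun hC => ?_, fun hC => hC ▸ h⟩
  obtain ⟨σ, hσ⟩ := hC.2.1.exists_mem
  exact hC.eq_of_mem h hσ (hC.1 hσ)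

theorem exists_isComponent {B : PreAbstractSimplicialComplex V} {σ : Finset V} (hσ : σ ∈ B) :
    ∃ C, IsComponent C B ∧ σ ∈ C := by
  obtain ⟨v, hv⟩ := nonempty_of_mem hσ
  let r : V → V → Prop := fun a b => ({a, b} : Finset V) ∈ B
  have hr : ∀ τ ∈ B, ∀ w ∈ τ, ∀ u ∈ τ, r w u := fun τ hτ w hw u hu =>
    mem_of_subset hτ (by simp [Finset.insert_subset_iff, hw, hu]) (by simp)
  let C : PreAbstractSimplicialComplex V :=
    { faces := {τ | τ ∈ B ∧ ∀ w ∈ τ, Relation.ReflTransGen r v w}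
      isRelLowerSet_faces := fun τ h => ⟨nonempty_of_mem h.1, fun ρ hρ hne =>
        ⟨mem_of_subset h.1 hρ hne, fun w hw => h.2 w (hρ hw)⟩⟩ }
  have hCmem : ∀ {τ}, τ ∈ C ↔ τ ∈ B ∧ ∀ w ∈ τ, Relation.ReflTransGen r v w := Iff.rfl
  have hvC : {v} ∈ C := hCmem.2 ⟨singleton_mem hσ hv, by
    simpa using Relation.ReflTransGen.refl⟩
  have hstar : ∀ τ ∈ B, (∃ w ∈ τ, {w} ∈ C) → τ ∈ C := fun τ hτ ⟨w, hw, hwC⟩ =>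
    hCmem.2 ⟨hτ, fun u hu =>
      ((hCmem.1 hwC).2 w (Finset.mem_singleton_self w)).tail (hr τ hτ w hw u hu)⟩
  -- A path in `B` starting at `v` never leaves `C`, so `C` is connected through its own edges.
  have hreach : ∀ w, Relation.ReflTransGen r v w →
      {w} ∈ C ∧ Relation.ReflTransGen (fun a b => ({a, b} : Finset V) ∈ C) v w := by
    intro w h
    induction h with
    | refl => exact ⟨hvC, Relation.ReflTransGen.refl⟩
    | tail _ hbc ih =>
      have := hstar _ hbc ⟨_, Finset.mem_insert_self _ _, ih.1⟩
      exact ⟨singleton_mem this (by simp), ih.2.tail this⟩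
  refine ⟨C, ⟨fun τ h => h.1, ⟨⟨v, hvC⟩, fun w u hw hu => ?_⟩, hstar⟩,
    hstar σ hσ ⟨v, hv, hvC⟩⟩
  have : Std.Symm (fun a b => ({a, b} : Finset V) ∈ C) :=
    ⟨fun a b h => by rwa [Finset.pair_comm]⟩
  have hw' := (hreach w ((hCmem.1 hw).2 w (Finset.mem_singleton_self w))).2
  have hu' := (hreach u ((hCmem.1 hu).2 u (Finset.mem_singleton_self u))).2
  exact (Relation.ReflTransGen.stdSymm.symm _ _ hw').trans hu'

end Components

/-! ### Counting over components of a family -/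

section Families

variable {V ι : Type*} [DecidableEq V] {S : Set ι} {B : ι → PreAbstractSimplicialComplex V}

/-- In a family without common components, a simplex lies in as many components of members as it
lies in members. -/
theorem ncard_components_mem
    (hB : ∀ a ∈ S, ∀ b ∈ S, ∀ C, IsComponent C (B a) → IsComponent C (B b) → a = b)
    (σ : Finset V) :
    {C | (∃ a ∈ S, IsComponent C (B a)) ∧ σ ∈ C}.ncard = {a | a ∈ S ∧ σ ∈ B a}.ncard := by
  symm
  have hex : ∀ a ∈ {a | a ∈ S ∧ σ ∈ B a}, ∃ C, IsComponent C (B a) ∧ σ ∈ C := fun a ha =>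
    exists_isComponent ha.2
  choose f hf using hex
  refine Set.ncard_congr f (fun a ha => ⟨⟨a, ha.1, (hf a ha).1⟩, (hf a ha).2⟩) ?_ ?_
  · intro a b ha hb he
    exact hB a ha.1 b hb.1 _ (hf a ha).1 (he ▸ (hf b hb).1)
  · rintro C ⟨⟨a, ha, hC⟩, hσ⟩
    have hmem : a ∈ {a | a ∈ S ∧ σ ∈ B a} := ⟨ha, hC.1 hσ⟩
    exact ⟨a, hmem, (hf a hmem).1.eq_of_mem hC (hf a hmem).2 hσ⟩

variable [Finite V]

theorem eulerChar_eq_sum_components (B : PreAbstractSimplicialComplex V) :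
    ∑ᶠ C ∈ {C | IsComponent C B}, eulerChar C.faces = eulerChar B.faces := by
  have hB : B.faces = ⋃ C ∈ {C | IsComponent C B}, C.faces := by
    ext σ
    simp only [Set.mem_iUnion]
    constructor
    · intro h
      obtain ⟨C, hC, hσ⟩ := exists_isComponent h
      exact ⟨C, hC, hσ⟩
    · rintro ⟨C, hC, hσ⟩
      exact hC.1 hσ
  conv_rhs => rw [hB, eulerChar]
  rw [finsum_mem_biUnion _ (Set.toFinite _) fun C _ => finite_faces C]
  · rfl
  · intro C hC D hD hne
    exact Set.disjoint_left.2 fun σ h h' => hne (hC.eq_of_mem hD h h')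

/-- The components of the members of a family without common components: summing Euler
characteristics over them. -/
theorem sum_eulerChar_components [Finite ι]
    (hB : ∀ a ∈ S, ∀ b ∈ S, ∀ C, IsComponent C (B a) → IsComponent C (B b) → a = b) :
    ∑ᶠ C ∈ {C | ∃ a ∈ S, IsComponent C (B a)}, eulerChar C.faces =
      ∑ᶠ a ∈ S, eulerChar (B a).faces := by
  have h : {C | ∃ a ∈ S, IsComponent C (B a)} = ⋃ a ∈ S, {C | IsComponent C (B a)} := by
    ext C
    simp
  rw [h, finsum_mem_biUnion _ (Set.toFinite S) fun _ _ => Set.toFinite _]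
  · exact finsum_mem_congr rfl fun a _ => eulerChar_eq_sum_components (B a)
  · intro a ha b hb hne
    exact Set.disjoint_left.2 fun C h h' => hne (hB a ha b hb C h h')

end Families

/-! ### Elements of the boundary complex in codimension one and dimension zero -/

section Faces

theorem mem_inf_finset_inf {V : Type*} {K : PreAbstractSimplicialComplex V}
    {s : Finset (PreAbstractSimplicialComplex V)} {σ : Finset V} :
    σ ∈ K ⊓ s.inf id ↔ σ ∈ K ∧ ∀ A ∈ s, σ ∈ A := by
  classical
  refine and_congr_right fun hσ => ?_
  induction s using Finset.induction_on with
  -- The infimum of the empty set is `⊤`, which contains exactly the nonempty simplices.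
  | empty => exact iff_of_true (nonempty_of_mem hσ) (by simp)
  | insert A s _ ih =>
    rw [Finset.inf_insert, Finset.forall_mem_insert, ← ih]
    exact Iff.rfl

/-- The complex with a single vertex. -/
def point {V : Type*} (v : V) : PreAbstractSimplicialComplex V where
  faces := {{v}}
  isRelLowerSet_faces := by
    rintro σ rfl
    exact ⟨Finset.singleton_nonempty v, fun τ hτ hne => hne.subset_singleton_iff.1 hτ⟩

theorem mem_point {V : Type*} {v : V} {σ : Finset V} : σ ∈ point v ↔ σ = {v} := Iff.rfl

theorem point_injective {V : Type*} :
    Function.Injective (point : V → PreAbstractSimplicialComplex V) :=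
  fun v w h => by
    have : ({v} : Finset V) ∈ point w := h ▸ mem_point.2 rfl
    exact Finset.singleton_injective (mem_point.1 this)

variable {V : Type*} [DecidableEq V]

theorem faceSet_codim_one {n : ℕ} {X : PatternedComplex V} (hle : ∀ A ∈ X.pattern, A ≤ X.carrier)
    (hconn : ∀ A ∈ X.pattern, IsConnected A) : faceSet (n + 1) n X = X.pattern := by
  ext C
  constructor
  · rintro ⟨s, hs, hcard, hC⟩
    obtain ⟨A, rfl⟩ := Finset.card_eq_one.1 (show s.card = 1 by omega)
    have hA : A ∈ X.pattern := hs (by simp)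
    rw [Finset.inf_singleton, id, inf_eq_right.2 (hle A hA)] at hC
    exact (hconn A hA).isComponent_iff.1 hC ▸ hA
  · intro hC
    refine ⟨{C}, by simpa using hC, by simp [add_comm], ?_⟩
    rw [Finset.inf_singleton, id, inf_eq_right.2 (hle C hC)]
    exact (hconn C hC).isComponent_iff.2 rfl

theorem isComponent_iff_of_card_le_one {B C : PreAbstractSimplicialComplex V}
    (hB : ∀ σ ∈ B, σ.card ≤ 1) : IsComponent C B ↔ ∃ v, {v} ∈ B ∧ point v = C := by
  have key : ∀ v, {v} ∈ B → IsComponent (point v) B := by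
    intro v hv
    refine ⟨?_, ⟨⟨v, mem_point.2 rfl⟩, fun a b ha hb => ?_⟩, ?_⟩
    · rintro σ rfl
      exact hv
    · rw [mem_point, Finset.singleton_inj] at ha hb
      rw [ha, hb]
    · rintro σ hσ ⟨w, hw, hwv⟩
      rw [mem_point, Finset.singleton_inj] at hwv
      subst hwv
      exact mem_point.2 (Finset.eq_singleton_iff_unique_mem.2
        ⟨hw, fun u hu => Finset.card_le_one.1 (hB σ hσ) u hu w hw⟩)
  constructor
  · intro hC
    obtain ⟨v, hv⟩ := hC.2.1.1
    exact ⟨v, hC.1 hv, (key v (hC.1 hv)).eq_of_mem hC (mem_point.2 rfl) hv⟩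
  · rintro ⟨v, hv, rfl⟩
    exact key v hv

/-- If `n`-fold intersections of faces are discrete, then the `0`-dimensional elements of the
boundary complex are the vertices lying in at least `n` faces. -/
theorem faceNumber_zero [Finite V] {n : ℕ} {X : PatternedComplex V}
    (h : ∀ s : Finset (PreAbstractSimplicialComplex V), ↑s ⊆ X.pattern → s.card = n →
      ∀ σ ∈ X.carrier ⊓ s.inf id, σ.card ≤ 1) :
    faceNumber n 0 X =
      {v | {v} ∈ X.carrier ∧ n ≤ {A | A ∈ X.pattern ∧ {v} ∈ A}.ncard}.ncard := by
  refine Eq.trans ?_ (Set.ncard_image_of_injective _ point_injective)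
  rw [faceNumber]
  congr 1
  ext C
  constructor
  · rintro ⟨s, hs, hcard, hC⟩
    rw [isComponent_iff_of_card_le_one (h s hs hcard)] at hC
    obtain ⟨v, hv, rfl⟩ := hC
    rw [mem_inf_finset_inf] at hv
    refine ⟨v, ⟨hv.1, ?_⟩, rfl⟩
    have hsub : (s : Set (PreAbstractSimplicialComplex V)) ⊆ {A | A ∈ X.pattern ∧ {v} ∈ A} :=
      fun A hA => ⟨hs hA, hv.2 A hA⟩
    have := Set.ncard_le_ncard hsub (Set.toFinite _)
    rw [Set.ncard_coe_finset] at this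
    omega
  · rintro ⟨v, ⟨hv, hn⟩, rfl⟩
    -- Any `n` of the faces through `v` will do: `faceSet` is a set, so the choice does not affect
    -- the count.
    obtain ⟨t, ht, hcard⟩ := Set.exists_subset_card_eq hn
    have hfin : t.Finite := Set.toFinite t
    have hs : ((hfin.toFinset : Finset (PreAbstractSimplicialComplex V)) :
      Set (PreAbstractSimplicialComplex V)) ⊆ X.pattern := by
      rw [hfin.coe_toFinset]
      exact fun A hA => (ht hA).1
    have hc : hfin.toFinset.card = n := by rw [← Set.ncard_eq_toFinset_card, hcard]
    refine ⟨hfin.toFinset, hs, hc, (isComponent_iff_of_card_le_one (h _ hs hc)).2 ⟨v, ?_, rfl⟩⟩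
    rw [mem_inf_finset_inf]
    exact ⟨hv, fun A hA => (ht (hfin.mem_toFinset.1 hA)).2⟩

variable {n : ℕ} {K : PreAbstractSimplicialComplex V} {P : Set (PreAbstractSimplicialComplex V)}

theorem IntersectsInManifolds.isManifold_inf (h : IntersectsInManifolds (n + 1) K P)
    {A : PreAbstractSimplicialComplex V} (hA : A ∈ P) : IsManifold n (K ⊓ A) := by
  simpa using (h {A} (by simpa using hA) (by simp)).1 (by simp)

theorem IntersectsInManifolds.card_le_of_mem_of_mem (h : IntersectsInManifolds (n + 2) K P)
    {A B : PreAbstractSimplicialComplex V} (hA : A ∈ P) (hB : B ∈ P) (hne : A ≠ B)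
    {σ : Finset V} (hσ : σ ∈ K) (hσA : σ ∈ A) (hσB : σ ∈ B) : σ.card ≤ n + 1 := by
  classical
  have hc := Finset.card_pair hne
  have := (h {A, B} (by simp [Set.insert_subset_iff, hA, hB]) (by simp)).1 (by omega)
  have := (this σ (mem_inf_finset_inf.2 ⟨hσ, by simp [hσA, hσB]⟩)).1
  rw [hc] at this
  omega

theorem IntersectsInManifolds.card_le_one (h : IntersectsInManifolds (n + 1) K P)
    {s : Finset (PreAbstractSimplicialComplex V)} (hs : ↑s ⊆ P) (hcard : s.card = n + 1)
    {σ : Finset V} (hσ : σ ∈ K ⊓ s.inf id) : σ.card ≤ 1 := by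
  have := ((h s hs (Finset.card_pos.1 (by omega))).1 hcard.le σ hσ).1
  rwa [hcard, Nat.sub_self] at this

theorem IntersectsInManifolds.ncard_le [Finite V] (h : IntersectsInManifolds n K P)
    {σ : Finset V} (hσ : σ ∈ K) : {A | A ∈ P ∧ σ ∈ A}.ncard ≤ n := by
  by_contra hlt
  have hfin : {A | A ∈ P ∧ σ ∈ A}.Finite := Set.toFinite _
  rw [Set.ncard_eq_toFinset_card _ hfin, not_le] at hlt
  have := (h hfin.toFinset (fun A hA => (hfin.mem_toFinset.1 hA).1)
    (Finset.card_pos.1 (by omega))).2 hlt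
  have hmem : σ ∈ K ⊓ hfin.toFinset.inf id :=
    mem_inf_finset_inf.2 ⟨hσ, fun A hA => (hfin.mem_toFinset.1 hA).2⟩
  rw [this] at hmem
  exact hmem

end Faces

/-! ### The induced pattern on a transverse hypersurface -/

section Hypersurface

variable {V : Type*} [DecidableEq V] {n : ℕ} {X : PatternedComplex V}
  {G : PreAbstractSimplicialComplex V}

theorem IsPatternedManifold.le_carrier (hX : IsPatternedManifold n X)
    {A : PreAbstractSimplicialComplex V} (hA : A ∈ X.pattern) : A ≤ X.carrier := fun σ hσ => by
  have : σ ∈ {σ | ∃ A ∈ X.pattern, σ ∈ A} := ⟨A, hA, hσ⟩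
  rw [hX.complete] at this
  exact this.1

variable [Finite V]

/-- Distinct faces of `X` have no common component of intersection with `G`. -/
theorem IsHypersurface.eq_of_isComponent (hG : IsHypersurface (n + 2) X G) :
    ∀ A ∈ X.pattern, ∀ B ∈ X.pattern, ∀ C, IsComponent C (G ⊓ A) → IsComponent C (G ⊓ B) →
      A = B := by
  intro A hA B hB C hCA hCB
  by_contra hne
  obtain ⟨σ, hσ⟩ := hCA.2.1.exists_mem
  -- By purity `C` contains a simplex with `n + 2` vertices, while `G ∩ A ∩ B` has dimension `n`.
  obtain ⟨τ, hτ, hsub, hcard⟩ := (hG.transverse.isManifold_inf hA).exists_card_eq (hCA.1 hσ)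
  obtain ⟨v, hv⟩ := nonempty_of_mem hσ
  have hτC : τ ∈ C := hCA.2.2 τ hτ ⟨v, hsub hv, singleton_mem hσ hv⟩
  have := hG.transverse.card_le_of_mem_of_mem hA hB hne hτ.1 hτ.2 (hCB.1 hτC).2
  omega

theorem IsHypersurface.ncard_induced (hG : IsHypersurface (n + 2) X G) {v : V} (hv : {v} ∈ G) :
    {C | C ∈ (induced X G).pattern ∧ {v} ∈ C}.ncard = {A | A ∈ X.pattern ∧ {v} ∈ A}.ncard := by
  refine (ncard_components_mem hG.eq_of_isComponent {v}).trans (congrArg _ ?_)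
  ext A
  exact ⟨fun h => ⟨h.1, h.2.2⟩, fun h => ⟨h.1, hv, h.2⟩⟩

theorem IsHypersurface.faceNumber_induced_zero (hG : IsHypersurface (n + 2) X G) :
    faceNumber (n + 2) 0 (induced X G) =
      {v | {v} ∈ G ∧ n + 2 ≤ {A | A ∈ X.pattern ∧ {v} ∈ A}.ncard}.ncard := by
  classical
  rw [faceNumber_zero]
  · congr 1
    ext v
    exact and_congr_right fun hv => by rw [hG.ncard_induced hv]
  · intro s hs hcard σ hσ
    rw [mem_inf_finset_inf] at hσ
    have hex : ∀ C ∈ s, ∃ A, A ∈ X.pattern ∧ IsComponent C (G ⊓ A) := fun C hC => hs hC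
    choose! f hf using hex
    -- Components of the same `G ⊓ A` that share `σ` coincide, so those in `s` come from distinct
    -- faces of `X`.
    have hinj : Set.InjOn f s := fun C hC D hD he =>
      (hf C hC).2.eq_of_mem (he ▸ (hf D hD).2) (hσ.2 C hC) (hσ.2 D hD)
    refine hG.transverse.card_le_one (s := s.image f) ?_ ?_ ?_
    · intro A hA
      obtain ⟨C, hC, rfl⟩ := Finset.mem_image.1 (Finset.mem_coe.1 hA)
      exact (hf C hC).1
    · rw [Finset.card_image_of_injOn hinj, hcard]
    · rw [mem_inf_finset_inf]
      refine ⟨hσ.1, fun A hA => ?_⟩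
      obtain ⟨C, hC, rfl⟩ := Finset.mem_image.1 hA
      exact ((hf C hC).2.1 (hσ.2 C hC)).2

theorem IsHypersurface.faceEuler_induced (hG : IsHypersurface (n + 2) X G) :
    faceEuler (n + 2) (n + 1) (induced X G) = ∑ᶠ A ∈ X.pattern, eulerChar (G ⊓ A).faces := by
  rw [faceEuler, faceSet_codim_one]
  · exact sum_eulerChar_components hG.eq_of_isComponent
  · rintro C ⟨A, -, hC⟩
    exact hC.1.trans inf_le_left
  · rintro C ⟨A, -, hC⟩
    exact hC.2.1

/-- A hypersurface is not contained in a face. -/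
theorem IsHypersurface.not_le (hG : IsHypersurface (n + 1) X G) (hGc : IsConnected G)
    {A : PreAbstractSimplicialComplex V} (hA : A ∈ X.pattern) : ¬ G ≤ A := by
  intro hle
  obtain ⟨σ, hσ⟩ := hGc.exists_mem
  obtain ⟨τ, hτ, -, hcard⟩ := hG.manifold.exists_card_eq hσ
  have := (hG.transverse.isManifold_inf hA τ ⟨hτ, hle hτ⟩).1
  omega

end Hypersurface

/-! ### Cutting open and the resulting formula -/

section Cutting

variable {V W : Type*} [DecidableEq V]

theorem bijOn_vertices {p : W → V} {S : Set (Finset W)} {T : Set (Finset V)}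
    (hb : Set.BijOn (Finset.image p) S T) (hcard : ∀ τ ∈ S, (τ.image p).card = τ.card)
    (Q : V → Prop) : Set.BijOn p {w | {w} ∈ S ∧ Q (p w)} {v | {v} ∈ T ∧ Q v} := by
  refine ⟨fun w hw => ⟨?_, hw.2⟩, fun w hw w' hw' he => ?_, fun v hv => ?_⟩
  · simpa using hb.mapsTo hw.1
  · refine Finset.singleton_injective (hb.injOn hw.1 hw'.1 ?_)
    simp [he]
  · obtain ⟨τ, hτ, he⟩ := hb.surjOn hv.1
    have h1 := hcard τ hτ
    rw [he, Finset.card_singleton] at h1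
    obtain ⟨w, rfl⟩ := Finset.card_eq_one.1 h1.symm
    rw [Finset.image_singleton, Finset.singleton_inj] at he
    exact ⟨w, ⟨hτ, he ▸ hv.2⟩, he⟩

theorem bijOn_inter_preimage {α β : Type*} {f : α → β} {S : Set α} {T : Set β}
    (hb : Set.BijOn f S T) (A : Set β) : Set.BijOn f (S ∩ f ⁻¹' A) (T ∩ A) := by
  refine ⟨fun x hx => ⟨hb.mapsTo hx.1, hx.2⟩, hb.injOn.mono Set.inter_subset_left, fun y hy => ?_⟩
  obtain ⟨x, hx, rfl⟩ := hb.surjOn hy.1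
  exact ⟨x, ⟨hx, hy.2⟩, rfl⟩

end Cutting

theorem phi_of_isCutOpen {V W : Type*} [Finite V] [DecidableEq V] [Finite W] [DecidableEq W]
    (X : PatternedComplex V) (G : PreAbstractSimplicialComplex V)
    (Y : PatternedComplex W)
    (hX : IsPatternedManifold 4 X)
    (hG : IsHypersurface 3 X G) (hGc : PLPattern.IsConnected G)
    (hY : IsPatternedManifold 4 Y) (hcut : IsCutOpen X G Y) :
    phi Y = phi X
      - (1 / 8 : ℝ) * faceNumber 3 0 (induced X G)
      + (1 / 4 : ℝ) * ((faceEuler 3 2 (induced X G) : ℝ)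
        + (eulerChar (boundary 3 G) : ℝ)) := by
  obtain ⟨p, Gp, Gm, hp, hGpY, hGmY, hdisj, hbp, hbm, hb, hpat⟩ := hcut
  have hcard : ∀ τ ∈ Y.carrier, (τ.image p).card = τ.card := fun τ hτ =>
    Finset.card_image_of_injOn (hp τ hτ).2
  have hnot : ∀ τ, τ ∈ Gp → τ ∈ Gm → False := fun τ h h' => by
    have : τ ∈ Gp ⊓ Gm := ⟨h, h'⟩
    rw [hdisj] at this
    exact this
  obtain ⟨σ₀, hσ₀⟩ := hGc.exists_mem
  obtain ⟨τp, hτp, -⟩ := hbp.surjOn hσ₀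
  -- The pair `{Gp, Gm}` must count as two faces; this needs `G` nonempty.
  have hGpGm : Gp ≠ Gm := fun h => hnot τp hτp (h ▸ hτp)
  -- components of the cut open faces
  set B : PreAbstractSimplicialComplex V → PreAbstractSimplicialComplex W :=
    fun A => preimage p Y.carrier A
  set P : Set (PreAbstractSimplicialComplex W) := {C | ∃ A ∈ X.pattern, IsComponent C (B A)}
  have hpat' : Y.pattern = P ∪ {Gp, Gm} := hpat
  -- A shared component is a face of `Y`, hence contains a simplex with four vertices. Its image
  -- under `p` keeps all four, but `A ∩ A'` is only two-dimensional.
  have hsep : ∀ A ∈ X.pattern, ∀ A' ∈ X.pattern, ∀ C, IsComponent C (B A) →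
      IsComponent C (B A') → A = A' := by
    intro A hA A' hA' C hC hC'
    by_contra hne
    obtain ⟨σ, hσ⟩ := hC.2.1.exists_mem
    have hCY : C ∈ Y.pattern := hpat' ▸ Or.inl ⟨A, hA, hC⟩
    obtain ⟨τ, hτ, -, hτc⟩ := (hY.inter.isManifold_inf hCY).exists_card_eq
      (show σ ∈ Y.carrier ⊓ C from ⟨(hC.1 hσ).1, hσ⟩)
    have := hX.inter.card_le_of_mem_of_mem hA hA' hne (hp τ hτ.1).1 (hC.1 hτ.2).2 (hC'.1 hτ.2).2
    rw [hcard τ hτ.1] at this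
    omega
  -- Otherwise `G` would lie inside a face of `X`, and a copy of `G` would be counted twice in the
  -- union.
  have hnotP : ∀ H : PreAbstractSimplicialComplex W,
      Set.BijOn (Finset.image p) H.faces G.faces → H ∉ P := by
    rintro H hH ⟨A, hA, hC⟩
    refine hG.not_le hGc hA fun σ hσ => ?_
    obtain ⟨τ, hτ, rfl⟩ := hH.surjOn hσ
    exact (hC.1 hτ).2
  -- Euler characteristics
  have hχ : ∀ A ∈ X.pattern,
      eulerChar (B A).faces = eulerChar A.faces + eulerChar (G ⊓ A).faces := by
    intro A hA
    have hAX := hX.le_carrier hA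
    have e0 := eulerChar_of_bijOn _ (bijOn_inter_preimage hb A.faces)
      fun τ hτ => hcard τ hτ.1.1
    have ep := eulerChar_of_bijOn _ (bijOn_inter_preimage hbp A.faces)
      fun τ hτ => hcard τ (hGpY hτ.1)
    have em := eulerChar_of_bijOn _ (bijOn_inter_preimage hbm A.faces)
      fun τ hτ => hcard τ (hGmY hτ.1)
    have hBs : (B A).faces =
        (((Y.carrier.faces \ (Gp.faces ∪ Gm.faces)) ∩ Finset.image p ⁻¹' A.faces) ∪
          (Gp.faces ∩ Finset.image p ⁻¹' A.faces)) ∪ (Gm.faces ∩ Finset.image p ⁻¹' A.faces) := by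
      rw [← Set.union_inter_distrib_right, ← Set.union_inter_distrib_right, Set.union_assoc,
        Set.sdiff_union_of_subset (Set.union_subset hGpY hGmY)]
      rfl
    have hAs : A.faces = ((X.carrier.faces \ G.faces) ∩ A.faces) ∪ (G.faces ∩ A.faces) := by
      rw [← Set.union_inter_distrib_right, Set.sdiff_union_of_subset hG.le,
        Set.inter_eq_right.2 hAX]
    have hAe : eulerChar A.faces = eulerChar ((X.carrier.faces \ G.faces) ∩ A.faces) +
        eulerChar (G.faces ∩ A.faces) := by
      rw [← eulerChar_union (Set.disjoint_left.2 fun σ h h' => h.1.2 h'.1) (Set.toFinite _)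
        (Set.toFinite _), ← hAs]
    have hGA : (G ⊓ A).faces = G.faces ∩ A.faces := rfl
    rw [hBs, eulerChar_union _ (Set.toFinite _) (Set.toFinite _),
      eulerChar_union _ (Set.toFinite _) (Set.toFinite _), e0, ep, em, hGA]
    · rw [hAe]
    · exact Set.disjoint_left.2 fun σ h h' => h.1.2 (Or.inl h'.1)
    · refine Set.disjoint_left.2 fun σ h h' => ?_
      rcases h with h | h
      · exact h.1.2 (Or.inr h'.1)
      · exact hnot σ h.1 h'.1
  have hχG : ∀ H : PreAbstractSimplicialComplex W, H ≤ Y.carrier →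
      Set.BijOn (Finset.image p) H.faces G.faces → eulerChar H.faces = eulerChar G.faces :=
    fun H hle hH => eulerChar_of_bijOn _ hH fun τ hτ => hcard τ (hle hτ)
  have hEX : faceEuler 4 3 X = ∑ᶠ A ∈ X.pattern, eulerChar A.faces := by
    rw [faceEuler, faceSet_codim_one (fun A hA => hX.le_carrier hA) hX.connected]
  have hEY : faceEuler 4 3 Y =
      faceEuler 4 3 X + faceEuler 3 2 (induced X G) + eulerChar (boundary 3 G) := by
    rw [faceEuler, faceSet_codim_one (fun A hA => hY.le_carrier hA) hY.connected, hpat',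
      finsum_mem_union _ (Set.toFinite _) (Set.toFinite _), sum_eulerChar_components hsep,
      finsum_mem_pair hGpGm, hχG Gp hGpY hbp, hχG Gm hGmY hbm, finsum_mem_congr rfl hχ,
      finsum_mem_add_distrib (Set.toFinite _), hEX, hG.faceEuler_induced,
      eulerChar_boundary_of_odd (by decide) (finite_faces G) hG.manifold]
    · ring
    · refine Set.disjoint_right.2 ?_
      rintro C (rfl | rfl)
      · exact hnotP _ hbp
      · exact hnotP _ hbm
  -- numbers of vertices
  let N : V → ℕ := fun v => {A | A ∈ X.pattern ∧ {v} ∈ A}.ncard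
  have hNP : ∀ w, {w} ∈ Y.carrier → {C | C ∈ P ∧ {w} ∈ C}.ncard = N (p w) := by
    intro w hw
    refine (ncard_components_mem hsep {w}).trans (congrArg _ ?_)
    ext A
    refine and_congr_right fun _ => ?_
    rw [← Finset.image_singleton p w]
    exact ⟨fun h => h.2, fun h => ⟨hw, h⟩⟩
  -- Stated for an arbitrary ordering of the two copies, so that it serves for both `Gp` and `Gm`.
  have hNin : ∀ H H' : PreAbstractSimplicialComplex W, P ∪ {H, H'} = Y.pattern → H ∉ P →
      ∀ w, {w} ∈ Y.carrier → {w} ∈ H → {w} ∉ H' →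
        {C | C ∈ Y.pattern ∧ {w} ∈ C}.ncard = N (p w) + 1 := by
    intro H H' he hHP w hw hwH hwH'
    have h1 : {C | C ∈ Y.pattern ∧ {w} ∈ C} = insert H {C | C ∈ P ∧ {w} ∈ C} := by
      ext C
      rw [← he]
      constructor
      · rintro ⟨h | rfl | rfl, hC⟩
        · exact Or.inr ⟨h, hC⟩
        · exact Or.inl rfl
        · exact absurd hC hwH'
      · rintro (rfl | ⟨h, hC⟩)
        · exact ⟨Or.inr (Or.inl rfl), hwH⟩
        · exact ⟨Or.inl h, hC⟩
    rw [h1, Set.ncard_insert_of_notMem (fun h => hHP h.1) (Set.toFinite _), hNP w hw]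
  have hNout : ∀ w, {w} ∈ Y.carrier → {w} ∉ Gp → {w} ∉ Gm →
      {C | C ∈ Y.pattern ∧ {w} ∈ C}.ncard = N (p w) := by
    intro w hw h h'
    rw [← hNP w hw, hpat']
    congr 1
    ext C
    constructor
    · rintro ⟨hC | rfl | rfl, hw⟩
      · exact ⟨hC, hw⟩
      · exact absurd hw h
      · exact absurd hw h'
    · exact fun hC => ⟨Or.inl hC.1, hC.2⟩
  have hfX : faceNumber 4 0 X =
      {v | {v} ∈ X.carrier.faces \ G.faces ∧ 4 ≤ N v}.ncard := by
    rw [faceNumber_zero fun s hs hc σ hσ => hX.inter.card_le_one hs hc hσ]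
    congr 1
    ext v
    refine ⟨fun h => ⟨⟨h.1, fun hv => ?_⟩, h.2⟩, fun h => ⟨h.1.1, h.2⟩⟩
    have := hG.transverse.ncard_le hv
    have := h.2
    omega
  have hfG : faceNumber 3 0 (induced X G) = {v | {v} ∈ G.faces ∧ 3 ≤ N v}.ncard :=
    hG.faceNumber_induced_zero
  have hfY : faceNumber 4 0 Y = faceNumber 4 0 X + 2 * faceNumber 3 0 (induced X G) := by
    rw [faceNumber_zero fun s hs hc σ hσ => hY.inter.card_le_one hs hc hσ, hfX, hfG, two_mul]
    have e0 := (bijOn_vertices hb (fun τ hτ => hcard τ hτ.1) (4 ≤ N ·)).ncard_eq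
    have ep := (bijOn_vertices hbp (fun τ hτ => hcard τ (hGpY hτ)) (3 ≤ N ·)).ncard_eq
    have em := (bijOn_vertices hbm (fun τ hτ => hcard τ (hGmY hτ)) (3 ≤ N ·)).ncard_eq
    rw [← e0]
    nth_rewrite 1 [← ep]
    rw [← em, ← Set.ncard_union_eq _ (Set.toFinite _) (Set.toFinite _),
      ← Set.ncard_union_eq _ (Set.toFinite _) (Set.toFinite _)]
    · congr 1
      ext w
      simp only [Set.mem_union, Set.mem_ofPred_eq, Set.mem_sdiff, mem_faces, not_or]
      by_cases h : {w} ∈ Gp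
      -- On a copy of `G` the number of faces is `N (p w) + 1`, so the threshold 4 in `Y` becomes 3
      -- for `N`.
      · have hw := hGpY h
        have h' : {w} ∉ Gm := hnot _ h
        have := hNin Gp Gm hpat'.symm (hnotP _ hbp) w hw h h'
        simp [h, h', this, mem_faces.1 hw]
      · by_cases h' : {w} ∈ Gm
        · have hw := hGmY h'
          have := hNin Gm Gp (by rw [hpat', Set.pair_comm]) (hnotP _ hbm) w hw h' h
          simp [h, h', this, mem_faces.1 hw]
        · by_cases hw : {w} ∈ Y.carrier
          · simp [h, h', hw, hNout w hw h h']
          · simp [h, h', hw]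
    · refine Set.disjoint_left.2 fun w h h' => ?_
      rcases h' with h' | h'
      · exact h.1.2 (Or.inl h'.1)
      · exact h.1.2 (Or.inr h'.1)
    · exact Set.disjoint_left.2 fun w h h' => hnot _ h.1 h'.1
  rw [phi, phi, hEY, hfY]
  push_cast
  ring

end PLPattern

theorem mainTheorem6 {V W : Type*} [Finite V] [DecidableEq V] [Finite W] [DecidableEq W]
    (X : PLPattern.PatternedComplex V) (G : PreAbstractSimplicialComplex V)
    (Y : PLPattern.PatternedComplex W)
    (hX : PLPattern.IsPatternedManifold 4 X)
    (hG : PLPattern.IsHypersurface 3 X G) (hGc : PLPattern.IsConnected G)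
    (hY : PLPattern.IsPatternedManifold 4 Y) (hcut : PLPattern.IsCutOpen X G Y) :
    PLPattern.phi Y = PLPattern.phi X
      - (1 / 8 : ℝ) * PLPattern.faceNumber 3 0 (PLPattern.induced X G)
      + (1 / 4 : ℝ) * ((PLPattern.faceEuler 3 2 (PLPattern.induced X G) : ℝ)
        + (PLPattern.eulerChar (PLPattern.boundary 3 G) : ℝ)) :=
  PLPattern.phi_of_isCutOpen X G Y hX hG hGc hY hcut
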